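/- There is an absolute constant $c>0$ such that the following holds for all integers $K>1$, $m\ge 1$ and $T\ge S:=Km$. A $K$-armed restless bandit consists of $K$ independent finite Markov chains (the arms), with transition matrices $P_j$ and initial laws, all of which make one transition in every time step $t=1,2,\dots$, whether pulled or not. In each step the learner pulls one arm $j$, observes the current state $s$ of this arm only, and receives a random reward $r_t$ with mean $r_j(s)\in[0,1]$. An algorithm (or policy) chooses each arm, possibly at random, on the basis of the arms pulled, the states observed and the rewards received so far. Let $\rho^*$ be the optimal average reward, that is, the supremum over all policies (which may depend on the bandit, but make the same observations as the learner) of $\liminf_{n\to\infty}\frac1n\,\mathbb{E}\big[\sum_{t=1}^n r_t\big]$. Then for every algorithm there is a $K$-armed restless bandit with irreducible and aperiodic arms having $m$ states each (hence $S=Km$ states in total), and with rewards in $\{0,1\}$, such that the expected regret of the algorithm after $T$ steps satisfies $$\mathbb{E}\Big[T\rho^*-\sum_{t=1}^T r_t\Big]\;\ge\; c\,\sqrt{ST}.$$ For the same bandit, also $\sup_{\pi}\mathbb{E}_\pi\big[\sum_{t=1}^T r_t\big]-\mathbb{E}\big[\sum_{t=1}^T r_t\big]\ge c\sqrt{ST}$,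 where the supremum is over all policies $\pi$ (which may depend on the bandit and on $T$). -/

import Mathlib

open scoped BigOperators

/-- A restless Markov bandit with `K` arms, each having `m` states (so `K * m` states in total).
Arm `j` carries a Markov chain with transition matrix `P j` and initial law `init j`; the chains
of the arms are independent.  Pulling arm `j` in state `s` gives a Bernoulli reward (0 or 1)
with mean `mean j s`. -/
structure RestlessBandit (K m : ℕ) where
  P : Fin K → Matrix (Fin m) (Fin m) ℝ
  P_stochastic : ∀ j, P j ∈ Matrix.rowStochastic ℝ (Fin m)
  init : Fin K → Fin m → ℝ
  init_mem : ∀ j, init j ∈ stdSimplex ℝ (Fin m)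
  mean : Fin K → Fin m → ℝ
  mean_mem : ∀ j s, mean j s ∈ Set.Icc (0 : ℝ) 1

/-- What the learner sees in one step: the arm that was pulled, the state of that arm, and the
reward (`true` for reward 1, `false` for reward 0). -/
structure BanditObs (K m : ℕ) where
  arm : Fin K
  state : Fin m
  reward : Bool
deriving DecidableEq, Fintype

/-- Everything that happens in one step: the (hidden) states of all the arms, the arm that is
pulled, and the reward (`true` for reward 1, `false` for reward 0). -/
structure BanditStep (K m : ℕ) where
  states : Fin K → Fin m
  arm : Fin K
  reward : Bool
deriving DecidableEq, Fintype

/-- The visible part of a step. -/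
def BanditStep.obs {K m : ℕ} (z : BanditStep K m) : BanditObs K m :=
  ⟨z.arm, z.states z.arm, z.reward⟩

/-- The reward of a step as a real number. -/
def BanditStep.value {K m : ℕ} (z : BanditStep K m) : ℝ :=
  if z.reward then 1 else 0

/-- An algorithm (or policy) of the learner, possibly randomized: it maps the history of the
first `n` observations to a probability distribution over the arms, according to which the next
arm is chosen. -/
structure BanditPolicy (K m : ℕ) where
  prob : (n : ℕ) → (Fin n → BanditObs K m) → Fin K → ℝ
  prob_mem : ∀ n h, prob n h ∈ stdSimplex ℝ (Fin K)

namespace RestlessBandit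

variable {K m : ℕ}

/-- Conditional probability that the joint state of the arms is `x` in the next step, given the
past: the initial law in the first step, and later one independent transition of every arm,
whether it was pulled or not. -/
def nextStateProb (B : RestlessBandit K m) :
    (n : ℕ) → (Fin n → BanditStep K m) → (Fin K → Fin m) → ℝ
  | 0, _, x => ∏ j, B.init j (x j)
  | n + 1, past, x => ∏ j, B.P j ((past (Fin.last n)).states j) (x j)

/-- Conditional probability of the reward `b` when arm `a` is pulled in state `s`. -/
def rewardProb (B : RestlessBandit K m) (a : Fin K) (s : Fin m) (b : Bool) : ℝ :=
  if b then B.mean a s else 1 - B.mean a s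

/-- Conditional probability that the next step is `z`, given the past, when the learner
uses `π`. -/
def nextStepProb (B : RestlessBandit K m) (π : BanditPolicy K m) (n : ℕ)
    (past : Fin n → BanditStep K m) (z : BanditStep K m) : ℝ :=
  B.nextStateProb n past z.states * π.prob n (fun i => (past i).obs) z.arm *
    B.rewardProb z.arm (z.states z.arm) z.reward

/-- Probability of the trajectory `ω` of the first `n` steps when the learner uses `π`. -/
def trajProb (B : RestlessBandit K m) (π : BanditPolicy K m) :
    (n : ℕ) → (Fin n → BanditStep K m) → ℝ
  | 0, _ => 1
  | n + 1, ω => trajProb B π n (Fin.init ω) * B.nextStepProb π n (Fin.init ω) (ω (Fin.last n))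

/-- Expectation of a function of the trajectory of the first `n` steps. -/
def expect (B : RestlessBandit K m) (π : BanditPolicy K m) (n : ℕ)
    (f : (Fin n → BanditStep K m) → ℝ) : ℝ :=
  ∑ ω : Fin n → BanditStep K m, B.trajProb π n ω * f ω

/-- Expected total reward of the policy `π` in the first `n` steps. -/
def expReward (B : RestlessBandit K m) (π : BanditPolicy K m) (n : ℕ) : ℝ :=
  B.expect π n (fun ω => ∑ t, (ω t).value)

/-- Average reward of the policy `π`: lower limit of the expected reward per step. -/
noncomputable def avgReward (B : RestlessBandit K m) (π : BanditPolicy K m) : ℝ :=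
  Filter.liminf (fun n : ℕ => B.expReward π n / n) Filter.atTop

/-- Optimal average reward `ρ*`: the supremum over all policies.  The policy may depend on the
bandit `B`, but it makes the same observations as the learner. -/
noncomputable def optAvgReward (B : RestlessBandit K m) : ℝ :=
  ⨆ π : BanditPolicy K m, B.avgReward π

/-- The largest expected total reward that a policy which may depend on `B` (and on `T`) can
collect in the first `T` steps. -/
noncomputable def optReward (B : RestlessBandit K m) (T : ℕ) : ℝ :=
  ⨆ π : BanditPolicy K m, B.expReward π T

/-- Expected regret `𝔼[T ρ* - ∑ r_t]` of the learner using `A` after `T` steps. -/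
noncomputable def regret (B : RestlessBandit K m) (A : BanditPolicy K m) (T : ℕ) : ℝ :=
  B.expect A T (fun ω => T * B.optAvgReward - ∑ t, (ω t).value)

/-- Expected regret of the learner using `A` with respect to the best policy for the first `T`
steps: `sup_π 𝔼_π[∑ r_t] - 𝔼_A[∑ r_t]`. -/
noncomputable def horizonRegret (B : RestlessBandit K m) (A : BanditPolicy K m) (T : ℕ) : ℝ :=
  B.expect A T (fun ω => B.optReward T - ∑ t, (ω t).value)

end RestlessBandit

/-- A Markov chain with transition matrix `M` is aperiodic if, for each state, the greatest
common divisor of the possible return times to this state is 1. -/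
def Matrix.IsAperiodic {m : ℕ} (M : Matrix (Fin m) (Fin m) ℝ) : Prop :=
  ∀ s, ∀ d : ℕ, (∀ n : ℕ, 0 < n → 0 < (M ^ n) s s → d ∣ n) → d = 1

/-! The hard instances are arms that rotate deterministically through their `m` states from a
uniform start, with fair rewards except on a random set `g` of (arm, state) pairs, where the mean is
`1 / 2 + δ`. Each of the `S` pairs is good independently with probability `p = 1 / (2 * K)`, and `δ`
has order `√(S / T)`.

Rotation limits the pulls of a single pair to about `T / m` (`pullCount_le`). A Hellinger-type
change of measure (`expect_pullCount_sub_le`) then bounds how much the goodness of a pair can raise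
its pull count. Averaging over `g` (`sum_bernoulliWeight_true_le`) shows that the learner makes
hardly more good pulls than `p * T`. A policy that knows `g` needs one look at each of `K / 2` arms
to predict their states forever; afterwards it finds a good pair with probability at least `p + 1 /
44` (`one_sub_pow_sub_ge`). The gap is of order `δ * T`, that is `√(S * T)`, for some `g`.

Rotation is periodic if `m > 1`, so a small uniform jump `ε` is added. Expected rewards over `T`
steps are continuous in `ε`, and the strict gap survives. The uniform law is stationary for every
`ε`, so replaying a `T`-step policy in blocks gives `T ρ*` at least its reward
(`IsStationary.expReward_le_mul_optAvgReward`). Both regrets are thus bounded by one comparison of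
policies. -/

/-- A step consists of the states of the arms, the pulled arm and the reward. -/
def BanditStep.equivProd (K m : ℕ) : (Fin K → Fin m) × Fin K × Bool ≃ BanditStep K m where
  toFun p := ⟨p.1, p.2.1, p.2.2⟩
  invFun z := ⟨z.states, z.arm, z.reward⟩
  left_inv _ := rfl
  right_inv _ := rfl

theorem BanditStep.sum_eq {K m : ℕ} (f : BanditStep K m → ℝ) :
    ∑ z, f z = ∑ x, ∑ a, ∑ b, f ⟨x, a, b⟩ := by
  rw [← (BanditStep.equivProd K m).sum_comp, Fintype.sum_prod_type]
  refine Finset.sum_congr rfl fun x _ => ?_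
  rw [Fintype.sum_prod_type]
  rfl

theorem Fin.sum_pi_eq_sum_snoc {α : Type*} [Fintype α] [DecidableEq α] {n : ℕ}
    (F : (Fin (n + 1) → α) → ℝ) :
    ∑ ω, F ω = ∑ ω : Fin n → α, ∑ z : α, F (Fin.snoc (α := fun _ => α) ω z) := by
  rw [← (Fin.snocEquiv (fun _ : Fin (n + 1) => α)).sum_comp, Fintype.sum_prod_type,
    Finset.sum_comm]
  rfl

/-! ### Expectations over finite trajectories -/

namespace RestlessBandit

variable {K m : ℕ} (B : RestlessBandit K m) (π : BanditPolicy K m)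

theorem _root_.BanditPolicy.prob_nonneg (n : ℕ) (h : Fin n → BanditObs K m) (a : Fin K) :
    0 ≤ π.prob n h a := (π.prob_mem n h).1 a

theorem _root_.BanditPolicy.sum_prob (n : ℕ) (h : Fin n → BanditObs K m) :
    ∑ a, π.prob n h a = 1 := (π.prob_mem n h).2

theorem P_nonneg (j : Fin K) (s s' : Fin m) : 0 ≤ B.P j s s' :=
  (Matrix.mem_rowStochastic.1 (B.P_stochastic j)).1 s s'

theorem sum_P (j : Fin K) (s : Fin m) : ∑ s', B.P j s s' = 1 := by
  have h := congrFun (Matrix.mem_rowStochastic.1 (B.P_stochastic j)).2 s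
  simpa [Matrix.mulVec, dotProduct] using h

theorem rewardProb_nonneg (a : Fin K) (s : Fin m) (b : Bool) : 0 ≤ B.rewardProb a s b := by
  have := B.mean_mem a s
  unfold rewardProb
  split_ifs
  · exact this.1
  · linarith [this.2]

theorem sum_rewardProb (a : Fin K) (s : Fin m) : ∑ b, B.rewardProb a s b = 1 := by
  simp [rewardProb]

theorem nextStateProb_nonneg (n : ℕ) (past : Fin n → BanditStep K m) (x : Fin K → Fin m) :
    0 ≤ B.nextStateProb n past x := by
  cases n with
  | zero => exact Finset.prod_nonneg fun j _ => (B.init_mem j).1 _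
  | succ n => exact Finset.prod_nonneg fun j _ => B.P_nonneg j _ _

theorem sum_nextStateProb (n : ℕ) (past : Fin n → BanditStep K m) :
    ∑ x, B.nextStateProb n past x = 1 := by
  cases n with
  | zero =>
    simp only [nextStateProb]
    rw [← Fintype.prod_sum]
    exact Finset.prod_eq_one fun j _ => (B.init_mem j).2
  | succ n =>
    simp only [nextStateProb]
    rw [← Fintype.prod_sum (fun j s => B.P j ((past (Fin.last n)).states j) s)]
    exact Finset.prod_eq_one fun j _ => B.sum_P j _

theorem nextStepProb_nonneg (n : ℕ) (past : Fin n → BanditStep K m) (z : BanditStep K m) :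
    0 ≤ B.nextStepProb π n past z :=
  mul_nonneg (mul_nonneg (B.nextStateProb_nonneg _ _ _) (π.prob_nonneg _ _ _))
    (B.rewardProb_nonneg _ _ _)

/-- One-step expectations, computed state by state, arm by arm and reward by reward. -/
theorem sum_nextStepProb_mul (n : ℕ) (past : Fin n → BanditStep K m) (f : BanditStep K m → ℝ) :
    ∑ z, B.nextStepProb π n past z * f z =
      ∑ x, B.nextStateProb n past x * ∑ a, π.prob n (fun i => (past i).obs) a *
        ∑ b, B.rewardProb a (x a) b * f ⟨x, a, b⟩ := by
  rw [BanditStep.sum_eq]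
  simp only [nextStepProb, Finset.mul_sum]
  refine Finset.sum_congr rfl fun x _ => Finset.sum_congr rfl fun a _ =>
    Finset.sum_congr rfl fun b _ => by ring

/-- The one-step expectation of a function of the states only. -/
theorem sum_nextStepProb_mul_states (n : ℕ) (past : Fin n → BanditStep K m)
    (f : (Fin K → Fin m) → ℝ) :
    ∑ z, B.nextStepProb π n past z * f z.states = ∑ x, B.nextStateProb n past x * f x := by
  rw [sum_nextStepProb_mul]
  refine Finset.sum_congr rfl fun x _ => ?_
  simp only [← Finset.sum_mul, B.sum_rewardProb, one_mul, π.sum_prob]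

theorem sum_nextStepProb (n : ℕ) (past : Fin n → BanditStep K m) :
    ∑ z, B.nextStepProb π n past z = 1 := by
  have := B.sum_nextStepProb_mul_states π n past (fun _ => 1)
  simpa [B.sum_nextStateProb] using this

theorem trajProb_nonneg (n : ℕ) (ω : Fin n → BanditStep K m) : 0 ≤ B.trajProb π n ω := by
  induction n with
  | zero => exact zero_le_one
  | succ n ih => exact mul_nonneg (ih _) (B.nextStepProb_nonneg π n _ _)

theorem trajProb_snoc (n : ℕ) (ω : Fin n → BanditStep K m) (z : BanditStep K m) :
    B.trajProb π (n + 1) (Fin.snoc (α := fun _ => BanditStep K m) ω z) =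
      B.trajProb π n ω * B.nextStepProb π n ω z := by
  simp [trajProb]

theorem expect_zero (f : (Fin 0 → BanditStep K m) → ℝ) : B.expect π 0 f = f Fin.elim0 := by
  have h : (default : Fin 0 → BanditStep K m) = Fin.elim0 := Subsingleton.elim _ _
  simp [expect, trajProb, h]

theorem expect_succ (n : ℕ) (f : (Fin (n + 1) → BanditStep K m) → ℝ) :
    B.expect π (n + 1) f = B.expect π n (fun ω => ∑ z, B.nextStepProb π n ω z *
      f (Fin.snoc (α := fun _ => BanditStep K m) ω z)) := by
  simp only [expect]
  rw [Fin.sum_pi_eq_sum_snoc]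
  refine Finset.sum_congr rfl fun ω _ => ?_
  rw [Finset.mul_sum]
  refine Finset.sum_congr rfl fun z _ => ?_
  rw [trajProb_snoc, mul_assoc]

/-- Null trajectories are exempt, so that deterministic motion and deterministic policies can be
exploited pathwise. -/
theorem expect_congr {n : ℕ} {f g : (Fin n → BanditStep K m) → ℝ}
    (h : ∀ ω, B.trajProb π n ω ≠ 0 → f ω = g ω) : B.expect π n f = B.expect π n g := by
  refine Finset.sum_congr rfl fun ω _ => ?_
  by_cases h0 : B.trajProb π n ω = 0
  · simp [h0]
  · rw [h ω h0]

theorem expect_mono {n : ℕ} {f g : (Fin n → BanditStep K m) → ℝ}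
    (h : ∀ ω, B.trajProb π n ω ≠ 0 → f ω ≤ g ω) : B.expect π n f ≤ B.expect π n g := by
  refine Finset.sum_le_sum fun ω _ => ?_
  by_cases h0 : B.trajProb π n ω = 0
  · simp [h0]
  · exact mul_le_mul_of_nonneg_left (h ω h0) (B.trajProb_nonneg π n ω)

theorem expect_add (n : ℕ) (f g : (Fin n → BanditStep K m) → ℝ) :
    B.expect π n (fun ω => f ω + g ω) = B.expect π n f + B.expect π n g := by
  simp [expect, mul_add, Finset.sum_add_distrib]

theorem expect_const_mul (n : ℕ) (c : ℝ) (f : (Fin n → BanditStep K m) → ℝ) :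
    B.expect π n (fun ω => c * f ω) = c * B.expect π n f := by
  simp only [expect, Finset.mul_sum]
  exact Finset.sum_congr rfl fun ω _ => by ring

theorem expect_sum {ι : Type*} (s : Finset ι) (n : ℕ) (f : ι → (Fin n → BanditStep K m) → ℝ) :
    B.expect π n (fun ω => ∑ i ∈ s, f i ω) = ∑ i ∈ s, B.expect π n (f i) := by
  simp only [expect, Finset.mul_sum]
  exact Finset.sum_comm

theorem expect_const (n : ℕ) (c : ℝ) : B.expect π n (fun _ => c) = c := by
  induction n with
  | zero => rw [expect_zero]
  | succ n ih => rw [expect_succ]; simpa only [← Finset.sum_mul, B.sum_nextStepProb, one_mul]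

theorem expect_sub (n : ℕ) (f g : (Fin n → BanditStep K m) → ℝ) :
    B.expect π n (fun ω => f ω - g ω) = B.expect π n f - B.expect π n g := by
  simp [expect, mul_sub, Finset.sum_sub_distrib]

theorem expect_nonneg {n : ℕ} {f : (Fin n → BanditStep K m) → ℝ} (h : ∀ ω, 0 ≤ f ω) :
    0 ≤ B.expect π n f :=
  Finset.sum_nonneg fun ω _ => mul_nonneg (B.trajProb_nonneg π n ω) (h ω)

theorem expect_sum_succ (n : ℕ) (f : ℕ → BanditStep K m → ℝ) :
    B.expect π (n + 1) (fun ω => ∑ t : Fin (n + 1), f t (ω t)) =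
      B.expect π n (fun ω => ∑ t : Fin n, f t (ω t)) +
        B.expect π n (fun ω => ∑ z, B.nextStepProb π n ω z * f n z) := by
  rw [expect_succ, ← expect_add]
  congr 1
  ext ω
  simp only [Fin.sum_univ_castSucc, Fin.snoc_castSucc, Fin.snoc_last, mul_add,
    Finset.sum_add_distrib, ← Finset.sum_mul, B.sum_nextStepProb, one_mul, Fin.val_castSucc,
    Fin.val_last]

/-- In an expected sum over the steps, the rewards may be averaged out. -/
theorem expect_sum_average_reward (n : ℕ) (f : BanditStep K m → ℝ) :
    B.expect π n (fun ω => ∑ t, f (ω t)) = B.expect π n (fun ω => ∑ t,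
      ∑ b, B.rewardProb (ω t).arm ((ω t).states (ω t).arm) b * f ⟨(ω t).states, (ω t).arm, b⟩) := by
  induction n with
  | zero => simp [expect_zero]
  | succ n ih =>
    rw [B.expect_sum_succ π n (fun _ => f), ih, B.expect_sum_succ π n (fun _ z =>
      ∑ b, B.rewardProb z.arm (z.states z.arm) b * f ⟨z.states, z.arm, b⟩)]
    congr 2
    ext ω
    rw [sum_nextStepProb_mul, sum_nextStepProb_mul]
    refine Finset.sum_congr rfl fun x _ => ?_
    congr 1
    refine Finset.sum_congr rfl fun a _ => ?_
    congr 1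
    simp only [← Finset.sum_mul, B.sum_rewardProb, one_mul]

theorem expReward_eq_mean (n : ℕ) :
    B.expReward π n =
      B.expect π n (fun ω => ∑ t, B.mean (ω t).arm ((ω t).states (ω t).arm)) := by
  rw [expReward, expect_sum_average_reward]
  simp [BanditStep.value, rewardProb]

/-- Every step of a trajectory of positive probability has positive conditional probability. -/
theorem nextStepProb_ne_zero {n : ℕ} {ω : Fin n → BanditStep K m} (h : B.trajProb π n ω ≠ 0)
    (t : Fin n) :
    B.nextStepProb π t (fun i => ω ⟨i, i.2.trans t.2⟩) (ω t) ≠ 0 := by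
  induction n with
  | zero => exact t.elim0
  | succ n ih =>
    have h' := mul_ne_zero_iff.1 h
    induction t using Fin.lastCases with
    | last => exact h'.2
    | cast t => exact ih h'.1 t

theorem expReward_nonneg (n : ℕ) : 0 ≤ B.expReward π n :=
  B.expect_nonneg π fun ω => Finset.sum_nonneg fun t _ => by
    unfold BanditStep.value; split_ifs <;> norm_num

theorem expReward_le (n : ℕ) : B.expReward π n ≤ n := by
  rw [← B.expect_const π n (n : ℝ)]
  refine B.expect_mono π fun ω _ => ?_
  calc ∑ t, (ω t).value ≤ ∑ _t : Fin n, (1 : ℝ) := Finset.sum_le_sum fun t _ => by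
        unfold BanditStep.value; split_ifs <;> norm_num
    _ = n := by simp

theorem expReward_le_optReward (n : ℕ) : B.expReward π n ≤ B.optReward n :=
  le_ciSup (f := fun π => B.expReward π n)
    ⟨n, by rintro _ ⟨π', rfl⟩; exact B.expReward_le π' n⟩ π

theorem regret_eq (n : ℕ) : B.regret π n = n * B.optAvgReward - B.expReward π n := by
  rw [regret, expect_sub, expect_const, expReward]

theorem horizonRegret_eq (n : ℕ) : B.horizonRegret π n = B.optReward n - B.expReward π n := by
  rw [horizonRegret, expect_sub, expect_const, expReward]

end RestlessBandit

/-! ### Stationary bandits: restarted policies and the optimal average reward -/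

/-- The policy that plays `π` in consecutive blocks of `T` steps and forgets everything at the
end of each block. -/
def BanditPolicy.restart {K m : ℕ} (π : BanditPolicy K m) (T : ℕ) : BanditPolicy K m where
  prob n h := π.prob (n % T) (fun i => h ⟨n - n % T + i, by have := Nat.mod_le n T; omega⟩)
  prob_mem _ _ := π.prob_mem _ _

theorem BanditPolicy.restart_prob {K m : ℕ} (π : BanditPolicy K m) {T r : ℕ} (k : ℕ)
    (hr : r < T) (h : Fin (k * T + r) → BanditObs K m) :
    (π.restart T).prob (k * T + r) h = π.prob r (fun i => h (Fin.natAdd (k * T) i)) := by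
  -- The history length `(k * T + r) % T` equals `r` only propositionally, so it is generalized
  -- before substitution.
  have key : ∀ r' (e : r' = r) (h' : Fin r' → BanditObs K m),
      (∀ i, h' i = h (Fin.natAdd (k * T) (Fin.cast e i))) →
      π.prob r' h' = π.prob r (fun i => h (Fin.natAdd (k * T) i)) := by
    rintro r' rfl h' hh
    congr 1
    ext1 i
    exact hh i
  have e : (k * T + r) % T = r := by
    rw [Nat.mul_comm, Nat.mul_add_mod, Nat.mod_eq_of_lt hr]
  refine key _ e _ fun i => ?_
  congr 1
  ext
  simp [e]

namespace RestlessBandit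

variable {K m : ℕ} (B : RestlessBandit K m) (π : BanditPolicy K m)

/-- The initial laws of the arms are stationary. -/
def IsStationary : Prop := ∀ j s', ∑ s, B.init j s * B.P j s s' = B.init j s'

variable {B}

/-- In a stationary bandit the states of the arms always have the initial law. -/
theorem IsStationary.expect_nextState (hB : B.IsStationary) (n : ℕ)
    (f : (Fin K → Fin m) → ℝ) :
    B.expect π n (fun ω => ∑ x, B.nextStateProb n ω x * f x) =
      ∑ x, (∏ j, B.init j (x j)) * f x := by
  induction n generalizing f with
  | zero => rw [expect_zero]; rfl
  | succ n ih =>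
    rw [expect_succ]
    simp only [nextStateProb, Fin.snoc_last]
    -- The induction hypothesis is used for `f` averaged over one more transition; stationarity then
    -- absorbs this transition arm by arm.
    have := ih (fun y => ∑ x, (∏ j, B.P j (y j) (x j)) * f x)
    simp only [← B.sum_nextStepProb_mul_states π] at this
    rw [this]
    simp only [Finset.mul_sum]
    rw [Finset.sum_comm]
    refine Finset.sum_congr rfl fun x _ => ?_
    simp only [← mul_assoc, ← Finset.sum_mul, ← Finset.prod_mul_distrib]
    rw [← Fintype.prod_sum (fun j s => B.init j s * B.P j s (x j))]
    simp only [hB _ _]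

theorem IsStationary.expect_sum_states (hB : B.IsStationary) (n : ℕ)
    (f : ℕ → (Fin K → Fin m) → ℝ) :
    B.expect π n (fun ω => ∑ t : Fin n, f t (ω t).states) =
      ∑ t : Fin n, ∑ x, (∏ j, B.init j (x j)) * f t x := by
  induction n with
  | zero => simp [expect_zero]
  | succ n ih =>
    rw [B.expect_sum_succ π n (fun t z => f t z.states), ih, Fin.sum_univ_castSucc]
    congr 1
    simp only [B.sum_nextStepProb_mul_states π]
    exact hB.expect_nextState π n _

theorem expect_castAdd (n r : ℕ) (f : (Fin n → BanditStep K m) → ℝ) :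
    B.expect π (n + r) (fun ω => f (fun i => ω (Fin.castAdd r i))) = B.expect π n f := by
  induction r with
  | zero => rfl
  | succ r ih =>
    rw [← ih]
    refine (B.expect_succ π (n + r) _).trans ?_
    congr 1
    ext ω
    rw [← one_mul (f _), ← B.sum_nextStepProb π (n + r) ω, Finset.sum_mul]
    refine Finset.sum_congr rfl fun z _ => ?_
    congr 2
    ext1 i
    exact Fin.snoc_castSucc (α := fun _ => BanditStep K m) z ω (Fin.castAdd r i)

/-- In each block the restarted policy does in law what the original policy does. -/
theorem IsStationary.expect_restart (hB : B.IsStationary) {T r : ℕ} (k : ℕ) (hr : r ≤ T)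
    (f : (Fin r → BanditStep K m) → ℝ) :
    B.expect (π.restart T) (k * T + r) (fun ω => f (fun i => ω (Fin.natAdd (k * T) i))) =
      B.expect π r f := by
  induction r with
  | zero =>
    rw [expect_zero, ← B.expect_const (π.restart T) (k * T + 0) (f Fin.elim0)]
    congr 1
    ext ω
    congr 1
    exact Subsingleton.elim _ _
  | succ r ih =>
    have hsnoc : ∀ (ω : Fin (k * T + r) → BanditStep K m) z,
        (fun i : Fin (r + 1) => Fin.snoc (α := fun _ => BanditStep K m) ω z
          (Fin.natAdd (k * T) i)) =
        Fin.snoc (α := fun _ => BanditStep K m) (fun i => ω (Fin.natAdd (k * T) i)) z := by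
      intro ω z
      ext1 i
      induction i using Fin.lastCases with
      | last =>
        rw [Fin.snoc_last]
        exact Fin.snoc_last (α := fun _ => BanditStep K m) z ω
      | cast i =>
        rw [Fin.snoc_castSucc]
        exact Fin.snoc_castSucc (α := fun _ => BanditStep K m) z ω (Fin.natAdd (k * T) i)
    refine (B.expect_succ (π.restart T) (k * T + r) _).trans ?_
    rw [B.expect_succ π]
    simp only [hsnoc]
    cases r with
    | zero =>
      rw [expect_zero]
      simp only [sum_nextStepProb_mul, π.restart_prob k (show 0 < T from hr)]
      -- At the start of a block the past matters only through the hidden states, and these again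
      -- have the initial law.
      refine Eq.trans ?_ (hB.expect_nextState (π.restart T) (k * T) (fun x => ∑ a,
        π.prob 0 (fun i => (Fin.elim0 i : BanditStep K m).obs) a * ∑ b, B.rewardProb a (x a) b *
          f (Fin.snoc (α := fun _ => BanditStep K m) Fin.elim0 ⟨x, a, b⟩)))
      congr 1
      ext ω
      refine Finset.sum_congr rfl fun x _ => ?_
      congr 1
      refine Finset.sum_congr rfl fun a _ => ?_
      congr 1
      congr 1
      ext1 i
      exact i.elim0
    | succ r =>
      -- Inside a block, the previous states and the observations used by `π` all belong to the
      -- block.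
      rw [← ih (by omega)]
      congr 1
      ext ω
      refine Finset.sum_congr rfl fun z _ => ?_
      congr 1
      unfold nextStepProb
      rw [π.restart_prob k (show r + 1 < T from hr)]
      rfl

theorem IsStationary.expReward_restart (hB : B.IsStationary) {T r : ℕ} (k : ℕ) (hr : r ≤ T) :
    B.expReward (π.restart T) (k * T + r) =
      k * B.expReward π T + B.expReward π r := by
  have step : ∀ k r, r ≤ T → B.expReward (π.restart T) (k * T + r) =
      B.expReward (π.restart T) (k * T) + B.expReward π r := by
    intro k r hr
    conv_lhs => rw [expReward]
    simp only [Fin.sum_univ_add, expect_add]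
    congr 1
    · exact expect_castAdd (π.restart T) (k * T) r (fun ω => ∑ t, (ω t).value)
    · exact hB.expect_restart π k hr (fun ω => ∑ t, (ω t).value)
  rw [step k r hr]
  congr 1
  induction k with
  | zero => rw [Nat.zero_mul]; simp [expReward, expect_zero]
  | succ k ih => rw [Nat.succ_mul, step k T le_rfl, ih]; push_cast; ring

theorem avgReward_le_one : B.avgReward π ≤ 1 := by
  have h : ∀ n : ℕ, B.expReward π n / n ≤ 1 := fun n =>
    div_le_one_of_le₀ (B.expReward_le π n) n.cast_nonneg
  have h0 : ∀ n : ℕ, 0 ≤ B.expReward π n / n := fun n =>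
    div_nonneg (B.expReward_nonneg π n) n.cast_nonneg
  refine Filter.liminf_le_of_le ?_ fun b hb => ?_
  · exact ⟨0, Filter.eventually_map.2 (Filter.Eventually.of_forall h0)⟩
  · obtain ⟨n, hn⟩ := hb.exists
    exact hn.trans (h n)

theorem IsStationary.le_avgReward_restart (hB : B.IsStationary) {T : ℕ} (hT : 0 < T) :
    B.expReward π T / T ≤ B.avgReward (π.restart T) := by
  set R := B.expReward π T
  have hR : 0 ≤ R := B.expReward_nonneg π T
  have hT' : (0 : ℝ) < T := by exact_mod_cast hT
  -- Only the complete blocks are counted, at least `n / T - 1` in number; the unfinished one earns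
  -- a nonnegative reward.
  have hlow : ∀ n : ℕ, 0 < n → R / T - R / n ≤ B.expReward (π.restart T) n / n := by
    intro n hn
    have hn' : (0 : ℝ) < n := by exact_mod_cast hn
    have h1 := hB.expReward_restart π (n / T) (Nat.mod_lt n hT).le
    rw [Nat.div_add_mod' n T] at h1
    have h2 : (n : ℝ) / T - 1 ≤ ((n / T : ℕ) : ℝ) := by
      have h3 : (n : ℝ) < ((n / T : ℕ) + 1 : ℝ) * T := by
        exact_mod_cast (Nat.div_lt_iff_lt_mul hT).1 (Nat.lt_succ_self (n / T))
      have := (div_lt_iff₀ hT').2 h3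
      linarith
    rw [le_div_iff₀ hn', h1]
    have h4 := mul_le_mul_of_nonneg_right h2 hR
    have h5 := B.expReward_nonneg π (n % T)
    have h6 : (R / T - R / n) * n = (n / T - 1) * R := by field_simp
    linarith
  have hlim : Filter.Tendsto (fun n : ℕ => R / T - R / n) Filter.atTop (nhds (R / T)) := by
    simpa using tendsto_const_nhds.sub (tendsto_const_div_atTop_nhds_zero_nat R)
  rw [← hlim.liminf_eq]
  refine Filter.liminf_le_liminf ?_ ?_ ?_
  · filter_upwards [Filter.eventually_gt_atTop 0] with n hn using hlow n hn
  · exact hlim.isBoundedUnder_ge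
  · refine Filter.IsBoundedUnder.isCoboundedUnder_ge ⟨1, Filter.eventually_map.2 ?_⟩
    exact Filter.Eventually.of_forall fun n =>
      div_le_one_of_le₀ (B.expReward_le _ n) n.cast_nonneg

/-- In a stationary bandit no policy earns more than `T ρ*` in `T` steps. -/
theorem IsStationary.expReward_le_mul_optAvgReward (hB : B.IsStationary) {T : ℕ} (hT : 0 < T) :
    B.expReward π T ≤ T * B.optAvgReward := by
  have h := (hB.le_avgReward_restart π hT).trans
    (le_ciSup (f := fun π => B.avgReward π)
      ⟨1, by rintro _ ⟨π', rfl⟩; exact avgReward_le_one π'⟩ (π.restart T))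
  have hT' : (0 : ℝ) < T := by exact_mod_cast hT
  rw [div_le_iff₀ hT'] at h
  rw [mul_comm]
  exact h

end RestlessBandit

/-! ### Change of measure for the reward of a single pair -/

/-- The arm that is pulled in a step, together with its state. -/
def BanditStep.pulled {K m : ℕ} (z : BanditStep K m) : Fin K × Fin m := (z.arm, z.states z.arm)

/-- The number of steps in which the arm `c.1` is pulled in the state `c.2`. -/
def BanditStep.pullCount {K m n : ℕ} (c : Fin K × Fin m) (ω : Fin n → BanditStep K m) : ℝ :=
  ∑ t, if (ω t).pulled = c then 1 else 0

/-- The log-likelihood ratio of the reward of a step when the mean reward of `c` changes from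
`1 / 2` to `1 / 2 + δ`. -/
noncomputable def BanditStep.logRatio {K m : ℕ} (δ : ℝ) (c : Fin K × Fin m)
    (z : BanditStep K m) : ℝ :=
  if z.pulled = c then Real.log (if z.reward then 1 + 2 * δ else 1 - 2 * δ) else 0

open BanditStep

theorem BanditStep.pullCount_nonneg {K m n : ℕ} (c : Fin K × Fin m)
    (ω : Fin n → BanditStep K m) : 0 ≤ pullCount c ω :=
  Finset.sum_nonneg fun t _ => by split_ifs <;> norm_num

theorem BanditStep.sum_pullCount {K m n : ℕ} (ω : Fin n → BanditStep K m) :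
    ∑ c, pullCount c ω = n := by
  unfold pullCount
  rw [Finset.sum_comm]
  simp

namespace RestlessBandit

variable {K m : ℕ} {B B' : RestlessBandit K m} (π : BanditPolicy K m)

/-- Transitions and the policy contribute the same factors to both laws. Only a reward at `c`
differs, by the ratio `(1 / 2 ± δ) / (1 / 2) = 1 ± 2 * δ`. -/
theorem nextStepProb_eq_mul_exp {δ : ℝ} {c : Fin K × Fin m} (hδ : 0 ≤ δ) (hδ' : 2 * δ < 1)
    (hP : B'.P = B.P) (hinit : B'.init = B.init)
    (hmean : ∀ a s, (a, s) ≠ c → B'.mean a s = B.mean a s)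
    (h0 : B.mean c.1 c.2 = 1 / 2) (h1 : B'.mean c.1 c.2 = 1 / 2 + δ)
    (n : ℕ) (past : Fin n → BanditStep K m) (z : BanditStep K m) :
    B'.nextStepProb π n past z = B.nextStepProb π n past z * Real.exp (logRatio δ c z) := by
  have hs : B'.nextStateProb n past z.states = B.nextStateProb n past z.states := by
    cases n <;> simp [nextStateProb, hP, hinit]
  have hr : B'.rewardProb z.arm (z.states z.arm) z.reward =
      B.rewardProb z.arm (z.states z.arm) z.reward * Real.exp (logRatio δ c z) := by
    by_cases hc : z.pulled = c
    · subst hc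
      simp only [pulled] at h0 h1
      unfold rewardProb logRatio
      rw [if_pos rfl, h0, h1, Real.exp_log (by split_ifs <;> linarith)]
      split_ifs <;> ring
    · have := hmean z.arm (z.states z.arm) hc
      simp [rewardProb, logRatio, hc, this]
  rw [nextStepProb, nextStepProb, hs, hr]
  ring

theorem trajProb_eq_mul_exp {δ : ℝ} {c : Fin K × Fin m} (hδ : 0 ≤ δ) (hδ' : 2 * δ < 1)
    (hP : B'.P = B.P) (hinit : B'.init = B.init)
    (hmean : ∀ a s, (a, s) ≠ c → B'.mean a s = B.mean a s)
    (h0 : B.mean c.1 c.2 = 1 / 2) (h1 : B'.mean c.1 c.2 = 1 / 2 + δ)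
    (n : ℕ) (ω : Fin n → BanditStep K m) :
    B'.trajProb π n ω = B.trajProb π n ω * Real.exp (∑ t, logRatio δ c (ω t)) := by
  induction n with
  | zero => simp [trajProb]
  | succ n ih =>
    rw [trajProb, trajProb, ih, nextStepProb_eq_mul_exp π hδ hδ' hP hinit hmean h0 h1,
      Fin.sum_univ_castSucc, Real.exp_add]
    simp only [Fin.init]
    ring

/-- The negative of the right-hand side is a relative entropy: each pull of `c` adds `-(1 / 2) * log
(1 - 4 * δ ^ 2)`, which is at most `4 * δ ^ 2` by `log y ≥ 1 - 1 / y`. -/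
theorem expect_sum_logRatio {δ : ℝ} {c : Fin K × Fin m} (hδ : 0 ≤ δ) (hδ' : 8 * δ ^ 2 ≤ 1)
    (h0 : B.mean c.1 c.2 = 1 / 2) (n : ℕ) :
    -(4 * δ ^ 2) * B.expect π n (pullCount c) ≤
      B.expect π n (fun ω => ∑ t, logRatio δ c (ω t)) := by
  have h2δ : 2 * δ < 1 := by nlinarith
  have hlog : -(4 * δ ^ 2) ≤
      1 / 2 * Real.log (1 + 2 * δ) + 1 / 2 * Real.log (1 - 2 * δ) := by
    rw [← mul_add, ← Real.log_mul (by linarith) (by linarith)]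
    have hpos : 0 < (1 + 2 * δ) * (1 - 2 * δ) := mul_pos (by linarith) (by linarith)
    have h3 := Real.one_sub_inv_le_log_of_pos hpos
    have h4 : ((1 + 2 * δ) * (1 - 2 * δ))⁻¹ ≤ 1 + 8 * δ ^ 2 := by
      rw [inv_le_iff_one_le_mul₀ hpos]
      nlinarith [mul_nonneg (sq_nonneg δ) (sub_nonneg.2 hδ')]
    linarith
  rw [expect_sum_average_reward, ← expect_const_mul]
  refine B.expect_mono π fun ω _ => ?_
  rw [pullCount, Finset.mul_sum]
  refine Finset.sum_le_sum fun t _ => ?_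
  by_cases hc : (ω t).pulled = c
  · have hc' : ∀ b, pulled ⟨(ω t).states, (ω t).arm, b⟩ = c := fun _ => hc
    have h0' : B.mean (ω t).arm ((ω t).states (ω t).arm) = 1 / 2 := by
      rw [← h0, ← hc]; rfl
    simp only [logRatio, hc', if_true, rewardProb, h0', Fintype.sum_bool]
    norm_num at hlog ⊢
    linarith
  · have hc' : ∀ b, pulled ⟨(ω t).states, (ω t).arm, b⟩ ≠ c := fun _ => hc
    simp [logRatio, hc']

/-- Raising the mean reward of `c` from `1 / 2` to `1 / 2 + δ` does not make a policy pull `c`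
much more often, unless it pulls `c` often anyway. -/
theorem expect_pullCount_sub_le {δ C θ : ℝ} {c : Fin K × Fin m} (hδ : 0 ≤ δ)
    (hδ' : 8 * δ ^ 2 ≤ 1) (hP : B'.P = B.P) (hinit : B'.init = B.init)
    (hmean : ∀ a s, (a, s) ≠ c → B'.mean a s = B.mean a s)
    (h0 : B.mean c.1 c.2 = 1 / 2) (h1 : B'.mean c.1 c.2 = 1 / 2 + δ) (n : ℕ) (hC : 0 ≤ C)
    (hcap : ∀ ω, B.trajProb π n ω ≠ 0 → pullCount c ω ≤ C) (hθ : 0 < θ) :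
    B'.expect π n (pullCount c) - B.expect π n (pullCount c) ≤
      2 * C * (θ + δ ^ 2 / θ * B.expect π n (pullCount c)) := by
  have h2δ : 2 * δ < 1 := by nlinarith
  set l : (Fin n → BanditStep K m) → ℝ := fun ω => ∑ t, logRatio δ c (ω t) with hl
  have htraj := trajProb_eq_mul_exp (B := B) π hδ h2δ hP hinit hmean h0 h1 n
  have hexp : ∀ f, B'.expect π n f = B.expect π n (fun ω => Real.exp (l ω) * f ω) := by
    intro f
    simp only [expect, htraj]
    exact Finset.sum_congr rfl fun ω _ => by rw [mul_assoc]
  have hone : B.expect π n (fun ω => Real.exp (l ω)) = 1 := by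
    have := hexp (fun _ => 1)
    rw [expect_const] at this
    simpa using this.symm
  have hll : B.expect π n (fun ω => -l ω) ≤ 4 * δ ^ 2 * B.expect π n (pullCount c) := by
    have h3 := expect_sum_logRatio (B := B) π hδ hδ' h0 n
    have h4 := B.expect_const_mul π n (-1) l
    simp only [neg_one_mul] at h4
    rw [h4]
    linarith
  rw [hexp, ← expect_sub]
  calc B.expect π n (fun ω => Real.exp (l ω) * pullCount c ω - pullCount c ω)
      ≤ B.expect π n (fun ω => C / 2 * (2 * θ * Real.exp (l ω) + 2 * θ + θ⁻¹ * -l ω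
          + θ⁻¹ * (Real.exp (l ω) - 1))) := by
        refine B.expect_mono π fun ω hω => ?_
        have hN := hcap ω hω
        have hN0 := pullCount_nonneg c ω
        -- With `u` the root of the likelihood ratio, `u ^ 2 - 1` factors as `(u - 1) * (u + 1)`,
        -- and a weighted AM-GM inequality separates the factors.
        set u := Real.exp (l ω / 2) with hu
        have hu2 : Real.exp (l ω) = u ^ 2 := by
          rw [hu, ← Real.exp_nat_mul]; congr 1; push_cast; ring
        have hu0 : 0 < u := Real.exp_pos _
        have hul : l ω / 2 + 1 ≤ u := Real.add_one_le_exp _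
        rw [hu2]
        have hi : 0 < θ⁻¹ := inv_pos.2 hθ
        have hm : θ * θ⁻¹ = 1 := mul_inv_cancel₀ hθ.ne'
        have habs : |u ^ 2 - 1| ≤ 1 / 2 * (θ * (u + 1) ^ 2 + θ⁻¹ * (u - 1) ^ 2) := by
          have e : ∀ x y : ℝ, x * y ≤ 1 / 2 * (θ * y ^ 2 + θ⁻¹ * x ^ 2) := by
            intro x y
            have h5 : 0 ≤ θ⁻¹ * (x - θ * y) ^ 2 := by positivity
            have h6 : θ⁻¹ * (x - θ * y) ^ 2 =
                θ⁻¹ * x ^ 2 - 2 * (θ * θ⁻¹) * (x * y) + (θ * θ⁻¹) * (θ * y ^ 2) := by ring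
            rw [h6, hm] at h5
            linarith
          rw [abs_le]
          constructor
          · nlinarith [e (-(u - 1)) (u + 1)]
          · nlinarith [e (u - 1) (u + 1)]
        calc u ^ 2 * pullCount c ω - pullCount c ω = pullCount c ω * (u ^ 2 - 1) := by ring
          _ ≤ pullCount c ω * |u ^ 2 - 1| := mul_le_mul_of_nonneg_left (le_abs_self _) hN0
          _ ≤ C * |u ^ 2 - 1| := mul_le_mul_of_nonneg_right hN (abs_nonneg _)
          _ ≤ C * (1 / 2 * (θ * (u + 1) ^ 2 + θ⁻¹ * (u - 1) ^ 2)) :=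
            mul_le_mul_of_nonneg_left habs hC
          _ = C / 2 * (θ * (u + 1) ^ 2 + θ⁻¹ * (u - 1) ^ 2) := by ring
          _ ≤ C / 2 * (2 * θ * u ^ 2 + 2 * θ + θ⁻¹ * -l ω + θ⁻¹ * (u ^ 2 - 1)) := by
            refine mul_le_mul_of_nonneg_left ?_ (by positivity)
            have h7 : θ * (u + 1) ^ 2 ≤ 2 * θ * u ^ 2 + 2 * θ := by
              nlinarith [mul_nonneg hθ.le (sq_nonneg (u - 1))]
            -- From `u ≥ 1 + l / 2`: the squared Hellinger distance is controlled by the relative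
            -- entropy. The extra `u ^ 2 - 1` has expectation zero.
            have h8 : θ⁻¹ * (u - 1) ^ 2 ≤ θ⁻¹ * (-l ω + (u ^ 2 - 1)) :=
              mul_le_mul_of_nonneg_left (by nlinarith) hi.le
            linarith
    _ = C / 2 * (4 * θ + θ⁻¹ * B.expect π n (fun ω => -l ω)) := by
        rw [expect_const_mul, expect_add, expect_add, expect_add, expect_const_mul,
          expect_const, expect_const_mul, expect_const_mul, expect_sub, expect_const, hone]
        ring
    _ ≤ C / 2 * (4 * θ + θ⁻¹ * (4 * δ ^ 2 * B.expect π n (pullCount c))) := by gcongr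
    _ = 2 * C * (θ + δ ^ 2 / θ * B.expect π n (pullCount c)) := by ring

end RestlessBandit

/-! ### The cyclic bandits -/

theorem BanditStep.sum_ite_pulled {K m n : ℕ} (g : Fin K × Fin m → Bool) (ω : Fin n → BanditStep K m) :
    (∑ t, if g (ω t).pulled then (1 : ℝ) else 0) = ∑ c, if g c then pullCount c ω else 0 := by
  have h : ∀ c, (if g c then pullCount c ω else 0) =
      ∑ t, if (ω t).pulled = c then (if g c then (1 : ℝ) else 0) else 0 := by
    intro c
    split_ifs <;> simp [pullCount]
  simp only [h]
  rw [Finset.sum_comm]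
  simp

/-- The bandit in which every arm moves to the next state cyclically, up to a uniformly distributed
jump with probability `ε`.  The arms start in the uniform law, and the mean rewards are
`1 / 2 + δ` where `g` is `true`, and `1 / 2` elsewhere. -/
noncomputable def cyclicBandit {K m : ℕ} [NeZero m] (δ : Set.Icc (0 : ℝ) (1 / 2))
    (ε : unitInterval) (g : Fin K × Fin m → Bool) : RestlessBandit K m where
  P _ := Matrix.of fun s s' => (1 - ε : ℝ) * (if s' = s + 1 then 1 else 0) + ε * (1 / m)
  P_stochastic j := by
    have hm : (m : ℝ) ≠ 0 := NeZero.ne _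
    rw [Matrix.mem_rowStochastic]
    constructor
    · intro s s'
      have h0 := ε.2.1
      have h1 := ε.2.2
      rw [Matrix.of_apply]
      refine add_nonneg (mul_nonneg (by linarith) (by split_ifs <;> norm_num)) ?_
      positivity
    · ext s
      simp [Matrix.mulVec, dotProduct, Finset.sum_add_distrib]
      field_simp
      ring
  init _ _ := 1 / m
  init_mem j := by
    have hm : (m : ℝ) ≠ 0 := NeZero.ne _
    refine ⟨fun _ => by positivity, ?_⟩
    simp [hm]
  mean j s := 1 / 2 + if g (j, s) then (δ : ℝ) else 0
  mean_mem j s := by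
    have h0 := δ.2.1
    have h1 := δ.2.2
    constructor <;> split_ifs <;> linarith

namespace cyclicBandit

variable {K m : ℕ} [NeZero m] (δ : Set.Icc (0 : ℝ) (1 / 2)) (ε : unitInterval)
  (g : Fin K × Fin m → Bool)

theorem isStationary : (cyclicBandit δ ε g).IsStationary := by
  intro j s'
  have hm : (m : ℝ) ≠ 0 := NeZero.ne _
  have h : ∑ s : Fin m, (if s' = s + 1 then (1 : ℝ) else 0) = 1 := by
    rw [Finset.sum_eq_single (s' - 1)]
    · simp
    · intro s _ hs
      exact if_neg fun e => hs (by rw [e]; simp)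
    · simp
  simp only [cyclicBandit, Matrix.of_apply]
  rw [← Finset.mul_sum, Finset.sum_add_distrib, ← Finset.mul_sum, h]
  simp
  field_simp
  ring

variable {ε} in
theorem P_pos (hε : 0 < ε) (j : Fin K) (s s' : Fin m) : 0 < (cyclicBandit δ ε g).P j s s' := by
  have hm : 0 < m := Nat.pos_of_neZero m
  have h0 : (0 : ℝ) < ε := hε
  have h1 := ε.2.2
  simp only [cyclicBandit, Matrix.of_apply]
  refine add_pos_of_nonneg_of_pos (mul_nonneg (by linarith) (by split_ifs <;> norm_num)) ?_
  positivity

variable {ε} in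
theorem isIrreducible (hε : 0 < ε) (j : Fin K) : ((cyclicBandit δ ε g).P j).IsIrreducible :=
  Matrix.IsPrimitive.isIrreducible
    ⟨(cyclicBandit δ ε g).P_nonneg j, 1, one_pos, by simpa using P_pos δ g hε j⟩

variable {ε} in
theorem isAperiodic (hε : 0 < ε) (j : Fin K) : ((cyclicBandit δ ε g).P j).IsAperiodic :=
  fun s _ hd => Nat.dvd_one.1 (hd 1 one_pos (by simpa using P_pos δ g hε j s s))

/-- A trajectory probability is a polynomial in `ε`. This is what transfers the gap from pure
rotation to irreducible aperiodic arms. -/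
theorem continuous_trajProb (π : BanditPolicy K m) (n : ℕ) (ω : Fin n → BanditStep K m) :
    Continuous fun ε => (cyclicBandit δ ε g).trajProb π n ω := by
  induction n with
  | zero => exact continuous_const
  | succ n ih =>
    refine (ih _).mul ?_
    have hr : Continuous fun ε => (cyclicBandit δ ε g).rewardProb (ω (Fin.last n)).arm
        ((ω (Fin.last n)).states (ω (Fin.last n)).arm) (ω (Fin.last n)).reward := by
      simp only [RestlessBandit.rewardProb, cyclicBandit]
      exact continuous_const
    refine Continuous.mul (Continuous.mul ?_ continuous_const) hr
    cases n with
    | zero =>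
      simp only [RestlessBandit.nextStateProb, cyclicBandit]
      exact continuous_const
    | succ n =>
      refine continuous_finsetProd _ fun j _ => ?_
      simp only [cyclicBandit, Matrix.of_apply]
      fun_prop

theorem continuous_expReward (π : BanditPolicy K m) (n : ℕ) :
    Continuous fun ε => (cyclicBandit δ ε g).expReward π n :=
  continuous_finsetSum _ fun ω _ => (continuous_trajProb δ g π n ω).mul continuous_const

variable {δ g} {π : BanditPolicy K m} {n : ℕ} {ω : Fin n → BanditStep K m}

theorem prob_ne_zero (h : (cyclicBandit δ ε g).trajProb π n ω ≠ 0) (t : Fin n) :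
    π.prob t (fun i => (ω ⟨i, i.2.trans t.2⟩).obs) (ω t).arm ≠ 0 :=
  (mul_ne_zero_iff.1
    (mul_ne_zero_iff.1 (RestlessBandit.nextStepProb_ne_zero _ π h t)).1).2

/-- Without jumps the arms move cyclically. -/
theorem states_succ (h : (cyclicBandit δ 0 g).trajProb π n ω ≠ 0) (t : ℕ) (ht : t + 1 < n)
    (j : Fin K) : (ω ⟨t + 1, ht⟩).states j = (ω ⟨t, t.lt_succ_self.trans ht⟩).states j + 1 := by
  have h1 := (mul_ne_zero_iff.1 (mul_ne_zero_iff.1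
    (RestlessBandit.nextStepProb_ne_zero _ π h ⟨t + 1, ht⟩)).1).1
  have h2 := Finset.prod_ne_zero_iff.1 h1 j (Finset.mem_univ j)
  by_contra hne
  apply h2
  simp only [cyclicBandit, Matrix.of_apply]
  rw [if_neg (by simpa using hne)]
  simp

theorem states_add (h : (cyclicBandit δ 0 g).trajProb π n ω ≠ 0) (i d : ℕ) (ht : i + d < n)
    (j : Fin K) : (ω ⟨i + d, ht⟩).states j =
      (ω ⟨i, (Nat.le_add_right i d).trans_lt ht⟩).states j + Fin.ofNat m d := by
  induction d with
  | zero => simp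
  | succ d ih =>
    have e : Fin.ofNat m (d + 1) = Fin.ofNat m d + 1 := by ext; simp [Fin.val_add]
    refine (states_succ h (i + d) ht j).trans ?_
    rw [e, ih (by omega), add_assoc]

/-- An arm is in a given state only at times of one residue class modulo `m`, and such times are
determined by their quotient by `m`. -/
theorem pullCount_le (h : (cyclicBandit δ 0 g).trajProb π n ω ≠ 0) (c : Fin K × Fin m) :
    pullCount c ω ≤ (n / m : ℕ) + 1 := by
  have hinj : Set.InjOn (fun t : Fin n => (t : ℕ) / m)
      (Finset.univ.filter fun t => (ω t).pulled = c) := by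
    intro t ht t' ht' e
    simp only [Finset.coe_filter, Finset.mem_univ, true_and, Set.mem_ofPred_eq] at ht ht' e
    have hst : ∀ t : Fin n, (ω t).pulled = c →
        c.2 = (ω ⟨0, t.pos⟩).states c.1 + Fin.ofNat m t := by
      intro t ht
      have h1 := states_add h 0 t (by simp) c.1
      rw [← h1, ← ht]
      simp [pulled]
    have h2 : Fin.ofNat m t = Fin.ofNat m t' :=
      add_left_cancel ((hst t ht).symm.trans (hst t' ht'))
    have h3 : (t : ℕ) % m = (t' : ℕ) % m := by
      simpa using congrArg Fin.val h2
    ext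
    rw [← Nat.div_add_mod (t : ℕ) m, ← Nat.div_add_mod (t' : ℕ) m, e, h3]
  have hmaps : Set.MapsTo (fun t : Fin n => (t : ℕ) / m)
      (Finset.univ.filter fun t => (ω t).pulled = c) (Finset.range (n / m + 1)) := by
    intro t _
    simpa [Nat.lt_succ_iff] using Nat.div_le_div_right t.2.le
  have := Finset.card_le_card_of_injOn _ hmaps hinj
  rw [Finset.card_range] at this
  rw [pullCount, Finset.sum_boole]
  exact_mod_cast this

theorem expReward_eq (δ : Set.Icc (0 : ℝ) (1 / 2)) (ε : unitInterval) (g : Fin K × Fin m → Bool)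
    (π : BanditPolicy K m) (n : ℕ) :
    (cyclicBandit δ ε g).expReward π n = n / 2 + δ * (cyclicBandit δ ε g).expect π n
      (fun ω => ∑ t, if g (ω t).pulled then 1 else 0) := by
  rw [RestlessBandit.expReward_eq_mean, ← RestlessBandit.expect_const_mul,
    ← (cyclicBandit δ ε g).expect_const π n ((n : ℝ) / 2), ← RestlessBandit.expect_add]
  congr 1
  ext ω
  have hmean : ∀ z : BanditStep K m, (cyclicBandit δ ε g).mean z.arm (z.states z.arm) =
      1 / 2 + δ * if g z.pulled then 1 else 0 := by
    intro z
    change 1 / 2 + (if g z.pulled then (δ : ℝ) else 0) = _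
    split_ifs <;> simp
  simp only [hmean, Finset.sum_add_distrib, Finset.mul_sum]
  simp only [Finset.sum_const, Finset.card_univ, Fintype.card_fin, nsmul_eq_mul, mul_one_div]

end cyclicBandit

/-! ### Averaging over a random set of good pairs -/

/-- The weight of `g` when its values are independent and `true` with probability `p`. -/
def bernoulliWeight {ι : Type*} [Fintype ι] (p : ℝ) (g : ι → Bool) : ℝ :=
  ∏ c, if g c then p else 1 - p

theorem bernoulliWeight_nonneg {ι : Type*} [Fintype ι] {p : ℝ} (hp : 0 ≤ p) (hp' : p ≤ 1)
    (g : ι → Bool) : 0 ≤ bernoulliWeight p g :=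
  Finset.prod_nonneg fun c _ => by split_ifs <;> linarith

section Bernoulli

variable {ι : Type*} [Fintype ι] [DecidableEq ι] {p : ℝ}

theorem sum_bernoulliWeight_mul_prod (p : ℝ) (f : ι → Bool → ℝ) :
    ∑ g, bernoulliWeight p g * ∏ c, f c (g c) = ∏ c, (p * f c true + (1 - p) * f c false) := by
  simp only [bernoulliWeight, ← Finset.prod_mul_distrib]
  rw [← Fintype.prod_sum (fun c b => (if b = true then p else 1 - p) * f c b)]
  simp

theorem sum_bernoulliWeight (p : ℝ) : ∑ g : ι → Bool, bernoulliWeight p g = 1 := by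
  simpa using sum_bernoulliWeight_mul_prod p (fun (_ : ι) _ => 1)

/-- The multiplicative form avoids dividing by a possibly vanishing `p` or `1 - p`. -/
theorem bernoulliWeight_update (p : ℝ) (g : ι → Bool) (c : ι) (b : Bool) :
    bernoulliWeight p (Function.update g c b) * (if g c then p else 1 - p) =
      bernoulliWeight p g * (if b then p else 1 - p) := by
  unfold bernoulliWeight
  rw [← Finset.mul_prod_erase _ _ (Finset.mem_univ c),
    ← Finset.mul_prod_erase _ (fun c => if g c then p else 1 - p) (Finset.mem_univ c)]
  have h : ∏ x ∈ Finset.univ.erase c, (if Function.update g c b x then p else 1 - p) =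
      ∏ x ∈ Finset.univ.erase c, (if g x then p else 1 - p) := by
    refine Finset.prod_congr rfl fun x hx => ?_
    rw [Function.update_of_ne (Finset.ne_of_mem_erase hx)]
  rw [h, Function.update_self]
  ring

/-- Resampling one coordinate does not change a Bernoulli average. -/
theorem sum_bernoulliWeight_resample (p : ℝ) (c : ι) (F : (ι → Bool) → ℝ) :
    ∑ g, bernoulliWeight p g * F g = ∑ g, bernoulliWeight p g *
      (p * F (Function.update g c true) + (1 - p) * F (Function.update g c false)) := by
  -- Exchanging the coordinate `g c` with an independent fresh bit is an involution that preserves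
  -- the joint weight.
  let e : (ι → Bool) × Bool ≃ (ι → Bool) × Bool :=
    Function.Involutive.toPerm (fun q => (Function.update q.1 c q.2, q.1 c)) (by
      intro q
      simp)
  have h := e.sum_comp (fun q => bernoulliWeight p q.1 * (if q.2 then p else 1 - p) * F q.1)
  rw [Fintype.sum_prod_type, Fintype.sum_prod_type] at h
  have hr : ∀ g : ι → Bool, ∑ b : Bool, bernoulliWeight p g * (if b then p else 1 - p) * F g =
      bernoulliWeight p g * F g := by
    intro g
    simp
    ring
  simp only [hr] at h
  rw [← h]
  refine Finset.sum_congr rfl fun g _ => ?_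
  change ∑ b, bernoulliWeight p (Function.update g c b) * (if g c then p else 1 - p) *
    F (Function.update g c b) = _
  simp only [bernoulliWeight_update]
  simp
  ring

/-- If the value of a random `g` at `c` has little influence on the `c`-th part `N g c` of a fixed
total, then the average part where `g` is `true` is little more than its share `p`. -/
theorem sum_bernoulliWeight_true_le (hp : 0 ≤ p) (hp' : p ≤ 1) {T C θ η : ℝ} (hC : 0 ≤ C)
    (hη : 0 ≤ η) (N : (ι → Bool) → ι → ℝ) (hN : ∀ g c, 0 ≤ N g c) (hsum : ∀ g, ∑ c, N g c = T)
    (hdiff : ∀ g c, N (Function.update g c true) c - N (Function.update g c false) c ≤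
      C * (θ + η * N (Function.update g c false) c)) (hθ : 0 ≤ θ) :
    ∑ g, bernoulliWeight p g * ∑ c, (if g c then N g c else 0) ≤
      p * T + p * C * (θ * Fintype.card ι + η * T) := by
  have hW := bernoulliWeight_nonneg (ι := ι) hp hp'
  set X : Bool → ℝ := fun b =>
    ∑ c, ∑ g, bernoulliWeight p g * N (Function.update g c b) c with hX
  -- Consequently `p * X true` exceeds `p * T` by exactly `p * (1 - p) * (X true - X false)`.
  have hT : p * X true + (1 - p) * X false = T := by
    have h1 : ∑ g, bernoulliWeight p g * ∑ c, N g c = T := by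
      simp only [hsum, ← Finset.sum_mul, sum_bernoulliWeight, one_mul]
    rw [← h1]
    simp only [Finset.mul_sum, hX]
    rw [Finset.sum_comm (γ := ι → Bool), ← Finset.sum_add_distrib]
    refine Finset.sum_congr rfl fun c _ => ?_
    rw [sum_bernoulliWeight_resample p c (fun g => N g c), ← Finset.sum_add_distrib]
    exact Finset.sum_congr rfl fun g _ => by ring
  have hG : ∑ g, bernoulliWeight p g * ∑ c, (if g c then N g c else 0) = p * X true := by
    simp only [Finset.mul_sum, hX]
    rw [Finset.sum_comm]
    refine Finset.sum_congr rfl fun c _ => ?_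
    rw [sum_bernoulliWeight_resample p c (fun g => if g c then N g c else 0)]
    refine Finset.sum_congr rfl fun g _ => ?_
    simp
    ring
  have hX0 : ∀ b, 0 ≤ X b := fun b =>
    Finset.sum_nonneg fun c _ => Finset.sum_nonneg fun g _ => mul_nonneg (hW g) (hN _ c)
  have hD : X true - X false ≤ C * (θ * Fintype.card ι + η * X false) := by
    calc X true - X false
        = ∑ c, ∑ g, bernoulliWeight p g *
            (N (Function.update g c true) c - N (Function.update g c false) c) := by
          simp only [hX, mul_sub, Finset.sum_sub_distrib]
      _ ≤ ∑ c, ∑ g, bernoulliWeight p g * (C * (θ + η * N (Function.update g c false) c)) :=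
          Finset.sum_le_sum fun c _ => Finset.sum_le_sum fun g _ =>
            mul_le_mul_of_nonneg_left (hdiff g c) (hW g)
      _ = ∑ c, (C * θ * ∑ g : ι → Bool, bernoulliWeight p g +
            C * η * ∑ g, bernoulliWeight p g * N (Function.update g c false) c) := by
          refine Finset.sum_congr rfl fun c _ => ?_
          rw [Finset.mul_sum, Finset.mul_sum, ← Finset.sum_add_distrib]
          exact Finset.sum_congr rfl fun g _ => by ring
      _ = C * (θ * Fintype.card ι + η * X false) := by
          rw [Finset.sum_add_distrib, ← Finset.mul_sum, sum_bernoulliWeight, ← Finset.mul_sum]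
          simp
          ring
  rw [hG]
  have hpX : 0 ≤ p * X true := mul_nonneg hp (hX0 true)
  have h2 : (1 - p) * (X true - X false) ≤ C * (θ * Fintype.card ι + η * T) := by
    calc (1 - p) * (X true - X false)
        ≤ (1 - p) * (C * (θ * Fintype.card ι + η * X false)) :=
          mul_le_mul_of_nonneg_left hD (by linarith)
      _ = C * ((1 - p) * (θ * Fintype.card ι) + η * ((1 - p) * X false)) := by ring
      _ ≤ C * (θ * Fintype.card ι + η * T) := by
          refine mul_le_mul_of_nonneg_left (add_le_add ?_ ?_) hC
          · exact mul_le_of_le_one_left (by positivity) (by linarith)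
          · exact mul_le_mul_of_nonneg_left (by linarith) hη
  calc p * X true = p * T + p * ((1 - p) * (X true - X false)) := by rw [← hT]; ring
    _ ≤ p * T + p * (C * (θ * Fintype.card ι + η * T)) := by gcongr
    _ = _ := by ring

end Bernoulli

/-- On average over a random `g`, a policy cannot find the pairs where `g` is `true` much more
often than by pure chance. -/
theorem cyclicBandit.sum_bernoulliWeight_goodPulls_le {K m : ℕ} [NeZero m] (hK : 0 < K) {T : ℕ}
    (hmT : m ≤ T) (δ : Set.Icc (0 : ℝ) (1 / 2)) {θ : ℝ} (hθ : 0 < θ)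
    (hδ : 8 * (δ : ℝ) ^ 2 ≤ 1) (hδθ : (δ : ℝ) ^ 2 * T = θ ^ 2 * (K * m : ℕ))
    (A : BanditPolicy K m) :
    ∑ g : Fin K × Fin m → Bool, bernoulliWeight (1 / (2 * K)) g *
      (cyclicBandit δ 0 g).expect A T (fun ω => ∑ t, if g (ω t).pulled then 1 else 0) ≤
      1 / (2 * K) * T + 4 * θ * T := by
  have hK' : (1 : ℝ) ≤ K := by exact_mod_cast hK
  have hm : 0 < m := Nat.pos_of_neZero m
  have hm' : (0 : ℝ) < m := by exact_mod_cast hm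
  have hmT' : (m : ℝ) ≤ T := by exact_mod_cast hmT
  have hδ0 : (0 : ℝ) ≤ δ := δ.2.1
  -- A pair is pulled at most `T / m + 1 ≤ 2 * T / m` times; the outer factor 2 comes from the
  -- change of measure. By `hδθ`, the two error terms contribute `2 * θ * T` each.
  have key := sum_bernoulliWeight_true_le (ι := Fin K × Fin m) (p := 1 / (2 * K)) (T := T)
    (C := 2 * (2 * T / m)) (θ := θ) (η := (δ : ℝ) ^ 2 / θ) (by positivity)
    (by rw [div_le_one (by positivity)]; linarith) (by positivity) (by positivity)
    (fun g c => (cyclicBandit δ 0 g).expect A T (pullCount c))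
    (fun g c => RestlessBandit.expect_nonneg _ A fun ω => pullCount_nonneg c ω)
    (fun g => by
      rw [← RestlessBandit.expect_sum]
      simp only [sum_pullCount, RestlessBandit.expect_const])
    (fun g c => by
      refine RestlessBandit.expect_pullCount_sub_le (C := 2 * T / m)
        (B := cyclicBandit δ 0 (Function.update g c false))
        (B' := cyclicBandit δ 0 (Function.update g c true)) A hδ0 hδ rfl rfl ?_ ?_ ?_ T (by positivity)
        (fun ω hω => (pullCount_le hω c).trans ?_) hθ
      · intro a s hne
        simp [cyclicBandit, Function.update_of_ne hne]
      · simp [cyclicBandit]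
      · simp [cyclicBandit]
      · have h1 : ((T / m : ℕ) : ℝ) ≤ T / m := Nat.cast_div_le
        have h2 : (1 : ℝ) ≤ T / m := (one_le_div hm').2 hmT'
        rw [mul_div_assoc]
        linarith) hθ.le
  have hgood : ∀ g : Fin K × Fin m → Bool, (cyclicBandit δ 0 g).expect A T
      (fun ω => ∑ t, if g (ω t).pulled then 1 else 0) =
      ∑ c, if g c then (cyclicBandit δ 0 g).expect A T (pullCount c) else 0 := by
    intro g
    simp only [sum_ite_pulled, RestlessBandit.expect_sum]
    refine Finset.sum_congr rfl fun c _ => ?_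
    split_ifs
    · rfl
    · exact RestlessBandit.expect_const _ A T 0
  simp only [hgood]
  refine key.trans (le_of_eq ?_)
  have h3 : (δ : ℝ) ^ 2 / θ * T = θ * (K * m : ℕ) := by
    rw [div_mul_eq_mul_div, hδθ]
    field_simp
  rw [h3]
  simp only [Fintype.card_prod, Fintype.card_fin]
  push_cast
  field_simp
  ring

/-! ### The informed policy -/

namespace cyclicBandit

variable {K m : ℕ}

open Classical in
/-- Whether the informed policy pulls an arm in a good state at time `t`, when the states of the
arms are `x`. -/
noncomputable def informedSuccess (g : Fin K × Fin m → Bool) (t : ℕ)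
    (x : Fin K → Fin m) : ℝ :=
  if ht : t < K / 2 then
    if g (⟨t, ht.trans_le (Nat.div_le_self K 2)⟩, x ⟨t, ht.trans_le (Nat.div_le_self K 2)⟩)
      then 1 else 0
  else if ∃ i : Fin K, (i : ℕ) ≤ K / 2 ∧ g (i, x i) then 1 else 0

/-- For fixed `x`, the pairs `(i, x i)` with `i ≤ K / 2` are `K / 2 + 1` distinct coordinates of
`g`, hence independent; late failure means that all of them are bad. -/
theorem sum_bernoulliWeight_informedSuccess (hK : 0 < K) (p : ℝ) (t : ℕ) (x : Fin K → Fin m) :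
    ∑ g, bernoulliWeight p g * informedSuccess g t x =
      if t < K / 2 then p else 1 - (1 - p) ^ (K / 2 + 1) := by
  split_ifs with ht
  · simp only [informedSuccess, dif_pos ht]
    set c : Fin K × Fin m := (⟨t, ht.trans_le (Nat.div_le_self K 2)⟩,
      x ⟨t, ht.trans_le (Nat.div_le_self K 2)⟩)
    rw [sum_bernoulliWeight_resample p c]
    simp only [Function.update_self]
    simp [← Finset.sum_mul, sum_bernoulliWeight]
  · simp only [informedSuccess, dif_neg ht]
    let f : Fin K × Fin m → Bool → ℝ := fun c b =>
      if (c.1 : ℕ) ≤ K / 2 ∧ c.2 = x c.1 ∧ b = true then 0 else 1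
    have hf : ∀ g : Fin K × Fin m → Bool,
        (if ∃ i : Fin K, (i : ℕ) ≤ K / 2 ∧ g (i, x i) = true then (1 : ℝ) else 0) =
          1 - ∏ c, f c (g c) := by
      intro g
      split_ifs with hex
      · obtain ⟨i, hi, hg⟩ := hex
        have h0 : ∏ c, f c (g c) = 0 :=
          Finset.prod_eq_zero (Finset.mem_univ (i, x i)) (if_pos ⟨hi, rfl, hg⟩)
        rw [h0, sub_zero]
      · rw [Finset.prod_eq_one fun c _ => if_neg ?_, sub_self]
        rintro ⟨hc, he, hg⟩
        exact hex ⟨c.1, hc, by rw [← he]; exact hg⟩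
    simp only [hf, mul_sub, Finset.sum_sub_distrib, mul_one, sum_bernoulliWeight,
      sum_bernoulliWeight_mul_prod]
    congr 1
    rw [Fintype.prod_prod_type]
    have hrow : ∀ i : Fin K, ∏ s : Fin m, (p * f (i, s) true + (1 - p) * f (i, s) false) =
        if (i : ℕ) ≤ K / 2 then 1 - p else 1 := by
      intro i
      rw [Finset.prod_eq_single (x i)]
      · by_cases hi : (i : ℕ) ≤ K / 2 <;> simp [f, hi]
      · intro s _ hs
        simp [f, hs]
      · simp
    simp only [hrow]
    rw [← Finset.prod_filter, Finset.prod_const]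
    congr 1
    have hlt : K / 2 < K := Nat.div_lt_self hK one_lt_two
    have : (Finset.univ.filter fun i : Fin K => (i : ℕ) ≤ K / 2) =
        Finset.Iic (⟨K / 2, hlt⟩ : Fin K) := by
      ext i
      simp [Fin.le_def]
    rw [this, Fin.card_Iic]

variable [NeZero m]

/-- The state of arm `i` at time `n`, extrapolated from the observation made at time `i`. -/
def predictedState (n : ℕ) (h : Fin n → BanditObs K m) (i : Fin K) : Fin m :=
  if hi : (i : ℕ) < n then (h ⟨i, hi⟩).state + Fin.ofNat m (n - i) else 0

open Classical in
/-- First pull the first half of the arms once each.  Then pull one of these arms for which the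
extrapolated state is good, if there is one, and another arm otherwise. -/
noncomputable def informedChoice (hK : 0 < K) (g : Fin K × Fin m → Bool) (n : ℕ)
    (h : Fin n → BanditObs K m) : Fin K :=
  if hn : n < K / 2 then ⟨n, hn.trans_le (Nat.div_le_self K 2)⟩
  else if hex : ∃ i : Fin K, (i : ℕ) < K / 2 ∧ g (i, predictedState n h i) then hex.choose
  else ⟨K / 2, Nat.div_lt_self hK one_lt_two⟩

/-- The policy that knows `g` and pulls the arms given by `informedChoice`. -/
noncomputable def informedPolicy (hK : 0 < K) (g : Fin K × Fin m → Bool) : BanditPolicy K m where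
  prob n h := Pi.single (informedChoice hK g n h) 1
  prob_mem _ _ := single_mem_stdSimplex ℝ _

variable {δ : Set.Icc (0 : ℝ) (1 / 2)} {g : Fin K × Fin m → Bool}

theorem arm_eq_informedChoice (hK : 0 < K) {ε : unitInterval} {n : ℕ}
    {ω : Fin n → BanditStep K m}
    (h : (cyclicBandit δ ε g).trajProb (informedPolicy hK g) n ω ≠ 0) (t : Fin n) :
    (ω t).arm = informedChoice hK g t (fun i => (ω ⟨i, i.2.trans t.2⟩).obs) := by
  by_contra hne
  exact prob_ne_zero ε h t (Pi.single_eq_of_ne hne 1)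

/-- Predictions are exact without jumps. The fallback arm `K / 2` needs no prediction: it is pulled
when all predicted states are bad, and then success means that its own state is good. So `K / 2`
observations yield a choice among `K / 2 + 1` arms. -/
theorem ite_pulled_eq_informedSuccess (hK : 0 < K) {n : ℕ}
    {ω : Fin n → BanditStep K m}
    (h : (cyclicBandit δ 0 g).trajProb (informedPolicy hK g) n ω ≠ 0) (t : Fin n) :
    (if g (ω t).pulled then (1 : ℝ) else 0) = informedSuccess g t (ω t).states := by
  have harm := arm_eq_informedChoice hK h
  have hearly : ∀ (s : Fin n) (hs : (s : ℕ) < K / 2),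
      (ω s).arm = ⟨s, hs.trans_le (Nat.div_le_self K 2)⟩ := by
    intro s hs
    rw [harm s, informedChoice, dif_pos hs]
  by_cases ht : (t : ℕ) < K / 2
  · simp only [informedSuccess, dif_pos ht, pulled, hearly t ht]
  · have hpred : ∀ i : Fin K, (i : ℕ) < K / 2 →
        predictedState t (fun i => (ω ⟨i, i.2.trans t.2⟩).obs) i = (ω t).states i := by
      intro i hi
      have hit : (i : ℕ) < t := by omega
      -- Arm `i` was observed at time `i` and has rotated `t - i` times since.
      have h1 := states_add h i (t - i) (by omega) i
      have h2 := hearly ⟨i, hit.trans t.2⟩ hi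
      rw [predictedState, dif_pos hit]
      simp only [BanditStep.obs, h2]
      rw [← h1]
      congr 2
      ext
      simp only
      omega
    have ha := harm t
    rw [informedChoice, dif_neg ht] at ha
    rw [informedSuccess, dif_neg ht]
    have hiff : g (ω t).pulled = true ↔
        ∃ i : Fin K, (i : ℕ) ≤ K / 2 ∧ g (i, (ω t).states i) = true := by
      constructor
      · intro hg
        refine ⟨(ω t).arm, ?_, hg⟩
        split_ifs at ha with hex
        · rw [ha]
          exact hex.choose_spec.1.le
        · rw [ha]
      · rintro ⟨i, hi, hg⟩
        split_ifs at ha with hex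
        · have h3 := hex.choose_spec
          rw [hpred _ h3.1] at h3
          rw [pulled, ha]
          exact h3.2
        · rcases hi.lt_or_eq with hlt | heq
          · exact (hex ⟨i, hlt, by rw [hpred i hlt]; exact hg⟩).elim
          · have h4 : (ω t).arm = i := by rw [ha]; ext; exact heq.symm
            rw [pulled, h4]
            exact hg
    exact if_congr hiff rfl rfl

theorem expect_informedPolicy (hK : 0 < K) (n : ℕ) :
    (cyclicBandit δ 0 g).expect (informedPolicy hK g) n
      (fun ω => ∑ t, if g (ω t).pulled then 1 else 0) =
      ∑ t : Fin n, ∑ x : Fin K → Fin m, (∏ _j : Fin K, (1 / m : ℝ)) *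
        informedSuccess g t x := by
  rw [RestlessBandit.expect_congr _ _ fun ω hω => Finset.sum_congr rfl fun t _ =>
    ite_pulled_eq_informedSuccess hK hω t]
  exact (isStationary δ 0 g).expect_sum_states _ n (fun t x => informedSuccess g t x)

/-- The average success of the informed policy over a random `g`. -/
theorem sum_bernoulliWeight_informedPolicy (hK : 0 < K) (p : ℝ) (δ : Set.Icc (0 : ℝ) (1 / 2))
    (n : ℕ) :
    ∑ g : Fin K × Fin m → Bool, bernoulliWeight p g *
      (cyclicBandit δ 0 g).expect (informedPolicy hK g) n
        (fun ω => ∑ t, if g (ω t).pulled then 1 else 0) =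
      ∑ t : Fin n, if (t : ℕ) < K / 2 then p else 1 - (1 - p) ^ (K / 2 + 1) := by
  have hm : (m : ℝ) ≠ 0 := NeZero.ne _
  simp only [expect_informedPolicy, Finset.mul_sum]
  rw [Finset.sum_comm]
  refine Finset.sum_congr rfl fun t _ => ?_
  rw [Finset.sum_comm]
  have h : ∀ x : Fin K → Fin m, ∑ g, bernoulliWeight p g * ((∏ _j : Fin K, (1 / m : ℝ)) *
      informedSuccess g t x) = (∏ _j : Fin K, (1 / m : ℝ)) *
        if (t : ℕ) < K / 2 then p else 1 - (1 - p) ^ (K / 2 + 1) := by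
    intro x
    rw [← sum_bernoulliWeight_informedSuccess hK p t x, Finset.mul_sum]
    exact Finset.sum_congr rfl fun g _ => by ring
  simp only [h]
  rw [Finset.sum_const, Finset.card_univ, Fintype.card_pi]
  simp [hm]

end cyclicBandit

/-! ### Choice of constants and conclusion -/

theorem Fin.sum_ite_val_lt {a T : ℕ} (h : a ≤ T) (p q : ℝ) :
    ∑ t : Fin T, (if (t : ℕ) < a then p else q) = a * p + (T - a) * q := by
  obtain ⟨b, rfl⟩ := Nat.exists_eq_add_of_le h
  rw [Fin.sum_univ_add]
  simp

/-- Having a choice among half of the arms is better than chance. -/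
theorem one_sub_pow_sub_ge {K : ℕ} (hK : 2 ≤ K) :
    1 / 44 ≤ (1 - (1 - 1 / (2 * K : ℝ)) ^ (K / 2 + 1)) - 1 / (2 * K) := by
  have hK' : (2 : ℝ) ≤ K := by exact_mod_cast hK
  set p : ℝ := 1 / (2 * K) with hp
  have hp0 : 0 < p := by positivity
  have hpK : p * K = 1 / 2 := by rw [hp]; field_simp
  have hp1 : p ≤ 1 / 4 := by nlinarith
  set n := K / 2 + 1 with hn
  have hn' : ((K : ℝ) + 1) / 2 ≤ n := by
    have : K + 1 ≤ 2 * n := by omega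
    have : (K : ℝ) + 1 ≤ 2 * n := by exact_mod_cast this
    linarith
  have h1 : 1 + n * p ≤ (1 + p) ^ n := one_add_mul_le_pow (by linarith) n
  -- This turns Bernoulli's inequality for `(1 + p) ^ n` into an upper bound for `(1 - p) ^ n`.
  have h2 : (1 - p) ^ n * (1 + p) ^ n ≤ 1 := by
    rw [← mul_pow]
    exact pow_le_one₀ (mul_nonneg (by linarith) (by linarith)) (by nlinarith)
  have h3 : 0 ≤ (1 - p) ^ n := pow_nonneg (by linarith) n
  have h4 : 5 / 4 + p / 2 ≤ 1 + n * p := by nlinarith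
  have h5 : (1 - p) ^ n * (5 / 4 + p / 2) ≤ 1 :=
    (mul_le_mul_of_nonneg_left (h4.trans h1) h3).trans h2
  by_contra! hcon
  have h6 : 43 / 44 - p < (1 - p) ^ n := by linarith
  have h7 : (43 / 44 - p) * (5 / 4 + p / 2) < (1 - p) ^ n * (5 / 4 + p / 2) :=
    mul_lt_mul_of_pos_right h6 (by linarith)
  -- The left side of `h7` is concave in `p`, above 1 at `p = 0` and exactly 1 at `p = 1 / 4`, the
  -- case `K = 2`; this fixes the constant `1 / 44`.
  nlinarith

/-- Some cyclic bandit without jumps is hard for the given policy. -/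
theorem cyclicBandit.exists_hard {K m T : ℕ} [NeZero m] (hK : 1 < K) (hT : K * m ≤ T)
    (A : BanditPolicy K m) :
    ∃ (δ : Set.Icc (0 : ℝ) (1 / 2)) (g : Fin K × Fin m → Bool) (π : BanditPolicy K m),
      1 / 278784 * Real.sqrt ((K * m : ℕ) * T) <
        (cyclicBandit δ 0 g).expReward π T - (cyclicBandit δ 0 g).expReward A T := by
  have hm : 0 < m := Nat.pos_of_neZero m
  have hK0 : 0 < K := by omega
  have hS : 0 < K * m := Nat.mul_pos hK0 hm
  have hTK : K ≤ T := (Nat.le_mul_of_pos_right K hm).trans hT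
  have hTm : m ≤ T := (Nat.le_mul_of_pos_left m hK0).trans hT
  have hS' : (0 : ℝ) < (K * m : ℕ) := by exact_mod_cast hS
  have hST' : ((K * m : ℕ) : ℝ) ≤ T := by exact_mod_cast hT
  have hT' : (0 : ℝ) < T := hS'.trans_le hST'
  set S : ℝ := ((K * m : ℕ) : ℝ) with hSdef
  set s := Real.sqrt (S * T) with hs
  have hs0 : 0 < s := Real.sqrt_pos.2 (mul_pos hS' hT')
  have hs2 : s ^ 2 = S * T := Real.sq_sqrt (mul_pos hS' hT').le
  have hsT : s ≤ T := by
    rw [hs, Real.sqrt_le_left hT'.le]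
    nlinarith
  -- This is `θ * √(S / T)` with `θ = 1 / 1056`, so that `d ^ 2 * T = θ ^ 2 * S`.
  set d : ℝ := 1 / 1056 * s / T with hd
  have hdT : d * T = 1 / 1056 * s := by rw [hd]; field_simp
  have hd0 : 0 ≤ d := by positivity
  have hd1 : d ≤ 1 / 1056 := by
    rw [hd, div_le_iff₀ hT']
    linarith
  let δ : Set.Icc (0 : ℝ) (1 / 2) := ⟨d, hd0, by linarith⟩
  have hδ : (δ : ℝ) = d := rfl
  set p : ℝ := 1 / (2 * K) with hp
  have hp0 : 0 ≤ p := by positivity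
  have hp1 : p ≤ 1 := by
    rw [hp, div_le_one (by positivity)]
    have : (1 : ℝ) < K := by exact_mod_cast hK
    linarith
  have hlow := sum_bernoulliWeight_goodPulls_le hK0 hTm δ (θ := 1 / 1056) (by norm_num)
    (by rw [hδ]; nlinarith)
    (by
      rw [hδ, hd]
      field_simp
      rw [hs2]
      ring) A
  have hhigh := sum_bernoulliWeight_informedPolicy (m := m) hK0 p δ T
  rw [Fin.sum_ite_val_lt ((Nat.div_le_self K 2).trans hTK)] at hhigh
  have hq := one_sub_pow_sub_ge hK
  have hhalf : (T : ℝ) / 2 ≤ T - (K / 2 : ℕ) := by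
    have h1 : 2 * (K / 2) ≤ T := by omega
    have h2 : 2 * ((K / 2 : ℕ) : ℝ) ≤ T := by exact_mod_cast h1
    linarith
  rw [← hp] at hlow hq
  set q := 1 - (1 - p) ^ (K / 2 + 1)
  -- If no `g` were hard, the average gap over `g` would be small as well.
  by_contra! hcon
  have hsum : ∑ g : Fin K × Fin m → Bool, bernoulliWeight p g *
      ((cyclicBandit δ 0 g).expReward (informedPolicy hK0 g) T -
        (cyclicBandit δ 0 g).expReward A T) ≤ 1 / 278784 * s := by
    calc _ ≤ ∑ g : Fin K × Fin m → Bool, bernoulliWeight p g * (1 / 278784 * s) :=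
          Finset.sum_le_sum fun g _ => mul_le_mul_of_nonneg_left
            (hcon δ g (informedPolicy hK0 g)) (bernoulliWeight_nonneg hp0 hp1 g)
      _ = 1 / 278784 * s := by rw [← Finset.sum_mul, sum_bernoulliWeight, one_mul]
  have hexpand : ∑ g : Fin K × Fin m → Bool, bernoulliWeight p g *
      ((cyclicBandit δ 0 g).expReward (informedPolicy hK0 g) T -
        (cyclicBandit δ 0 g).expReward A T) =
      d * (∑ g : Fin K × Fin m → Bool, bernoulliWeight p g *
        (cyclicBandit δ 0 g).expect (informedPolicy hK0 g) T
          (fun ω => ∑ t, if g (ω t).pulled then 1 else 0) -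
        ∑ g : Fin K × Fin m → Bool, bernoulliWeight p g * (cyclicBandit δ 0 g).expect A T
          (fun ω => ∑ t, if g (ω t).pulled then 1 else 0)) := by
    rw [← Finset.sum_sub_distrib, Finset.mul_sum]
    refine Finset.sum_congr rfl fun g _ => ?_
    rw [expReward_eq, expReward_eq, hδ]
    ring
  rw [hexpand, hhigh] at hsum
  -- The informed surplus `T / 88` minus the learner's surplus `4 * T / 1056`.
  have hgap : T / 132 ≤ ((K / 2 : ℕ) * p + (T - (K / 2 : ℕ)) * q) -
      ∑ g : Fin K × Fin m → Bool, bernoulliWeight p g * (cyclicBandit δ 0 g).expect A T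
          (fun ω => ∑ t, if g (ω t).pulled then 1 else 0) := by
    have h1 : (T : ℝ) / 2 * (1 / 44) ≤ (T - (K / 2 : ℕ)) * (q - p) :=
      mul_le_mul hhalf hq (by norm_num) (by linarith)
    linarith
  -- Here `d * T / 132 = s / 139392`, twice the claimed bound; the spare factor makes the inequality
  -- strict, as needed for passing to `ε > 0`.
  have hfin := mul_le_mul_of_nonneg_left hgap hd0
  linarith

theorem theorem3 :
    ∃ c : ℝ, 0 < c ∧
      ∀ (K m T : ℕ), 1 < K → 1 ≤ m → K * m ≤ T →
        ∀ A : BanditPolicy K m, ∃ B : RestlessBandit K m,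
          (∀ j, (B.P j).IsIrreducible ∧ (B.P j).IsAperiodic) ∧
          c * Real.sqrt ((K * m : ℕ) * T) ≤ B.regret A T ∧
          c * Real.sqrt ((K * m : ℕ) * T) ≤ B.horizonRegret A T := by
  refine ⟨1 / 278784, by norm_num, fun K m T hK hm hT A => ?_⟩
  have : NeZero m := ⟨by omega⟩
  obtain ⟨δ, g, π, hgap⟩ := cyclicBandit.exists_hard hK hT A
  have hcont : Continuous fun ε => (cyclicBandit δ ε g).expReward π T -
      (cyclicBandit δ ε g).expReward A T :=
    (cyclicBandit.continuous_expReward δ g π T).sub (cyclicBandit.continuous_expReward δ g A T)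
  have : (nhdsWithin (0 : unitInterval) (Set.Ioi 0)).NeBot :=
    nhdsGT_neBot_of_exists_gt ⟨1, zero_lt_one⟩
  -- The strict gap at `ε = 0` persists for some positive `ε`.
  obtain ⟨ε, hε, hpos⟩ := ((((hcont.tendsto 0).eventually_const_lt hgap).filter_mono
    nhdsWithin_le_nhds).and (self_mem_nhdsWithin (s := Set.Ioi (0 : unitInterval)))).exists
  have hT0 : 0 < T := (Nat.mul_pos (by omega) hm).trans_le hT
  have h1 := (cyclicBandit.isStationary δ ε g).expReward_le_mul_optAvgReward π hT0
  have h2 := (cyclicBandit δ ε g).expReward_le_optReward π T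
  refine ⟨cyclicBandit δ ε g,
    fun j => ⟨cyclicBandit.isIrreducible δ g hpos j, cyclicBandit.isAperiodic δ g hpos j⟩, ?_, ?_⟩
  · rw [RestlessBandit.regret_eq]
    linarith
  · rw [RestlessBandit.horizonRegret_eq]
    linarith
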